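/- Let $A$ be a commutative von Neumann regular ring with $1$ (for every $a\in A$ there is $b\in A$ with $aba=a$). Let $Q(A)$ be the complete ring of quotients of $A$: its elements are the $A$-linear maps $D\to A$ defined on dense ideals $D$ of $A$ (ideals annihilated only by $0$), two of them being identified when they agree on the intersection of their domains, with pointwise addition and with composition as multiplication; $A$ embeds in $Q(A)$ by letting $a$ act as multiplication by $a$. A commutative ring is Baer if the annihilator of each of its subsets is generated by an idempotent. Let $B(A)$ be the Baer hull of $A$, i.e. the smallest Baer ring $S$ with $A\subseteq S\subseteq Q(A)$ (the intersection of all such $S$), and let $$\phi:\operatorname{Spec} B(A)\to\operatorname{Spec} A,\qquad \mathfrak p\mapsto \mathfrak p\cap A,$$ be the canonical map. For a Hausdorff space $X$, an open ultrafilter on $X$ is a maximal proper filter of the lattice of open subsets of $X$. The Gleason space $\theta X$ is the set of open ultrafilters on $X$ with the topology generated by the sets $\{\mathcal U\in\theta X : U\in\mathcal U\}$, $U\subseteq X$ open. The Iliadis absolute of $X$ is the subspace $$\mathcal E X=\Big\{\mathcal U\in\theta X : \bigcap_{U\in\mathcal U}\overline{U}\neq\emptyset\Big\},$$ and its projection $\pi_X:\mathcal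 E X\to X$ sends $\mathcal U$ to the unique point of $\bigcap_{U\in\mathcal U}\overline{U}$. Then (the space $\operatorname{Spec} A$ being Hausdorff, since $A$ is von Neumann regular) there is a homeomorphism $\psi:\mathcal E\operatorname{Spec} A\to\operatorname{Spec} B(A)$ such that $\phi\circ\psi=\pi_{\operatorname{Spec} A}$. -/

import Mathlib

open TopologicalSpace

/-- `R` is von Neumann regular. -/
def IsVonNeumannRegular (R : Type*) [Ring R] : Prop :=
  ∀ a : R, ∃ b : R, a * b * a = a

/-- A commutative ring is Baer if the annihilator of every subset is generated by an idempotent. -/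
def IsBaerRing (R : Type*) [CommRing R] : Prop :=
  ∀ s : Set R, ∃ e : R, IsIdempotentElem e ∧
    ∀ x : R, x ∈ Ideal.span {e} ↔ ∀ y ∈ s, x * y = 0

/-! ### The complete ring of quotients -/

/-- An ideal is dense if only `0` annihilates it. -/
def IsDenseIdeal {A : Type*} [CommRing A] (D : Ideal A) : Prop :=
  ∀ r : A, (∀ d ∈ D, r * d = 0) → r = 0

/-- A fraction: an `A`-linear map into `A` defined on a dense ideal of `A`. -/
structure DenseFraction (A : Type*) [CommRing A] where
  dom : Ideal A
  dense : IsDenseIdeal dom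
  map : dom →ₗ[A] A

namespace DenseFraction

variable {A : Type*} [CommRing A]

theorem map_mul_mem (f : DenseFraction A) (a x : A) (hx : x ∈ f.dom) (h : a * x ∈ f.dom) :
    f.map ⟨a * x, h⟩ = a * f.map ⟨x, hx⟩ := by
  rw [← smul_eq_mul a (f.map _), ← f.map.map_smul]; rfl

theorem dense_inf {D E : Ideal A} (hD : IsDenseIdeal D) (hE : IsDenseIdeal E) :
    IsDenseIdeal (D ⊓ E) := by
  intro r hr
  refine hD r fun d hd => hE _ fun e he => ?_
  rw [mul_assoc]
  exact hr _ ⟨D.mul_mem_right e hd, E.mul_mem_left d he⟩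

/-- Two fractions are identified if they agree on the intersection of their domains. -/
instance setoid (A : Type*) [CommRing A] : Setoid (DenseFraction A) where
  r f g := ∀ x (hf : x ∈ f.dom) (hg : x ∈ g.dom), f.map ⟨x, hf⟩ = g.map ⟨x, hg⟩
  iseqv :=
    { refl := fun _ _ _ _ => rfl
      symm := fun h x hg hf => (h x hf hg).symm
      trans := by
        intro f g k h₁ h₂ x hf hk
        rw [← sub_eq_zero]
        refine g.dense _ fun d hd => ?_
        have e1 := f.map_mul_mem d x hf (f.dom.mul_mem_left d hf)
        have e2 := k.map_mul_mem d x hk (k.dom.mul_mem_left d hk)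
        have hg : d * x ∈ g.dom := g.dom.mul_mem_right x hd
        rw [mul_comm, mul_sub, ← e1, ← e2, h₁ _ _ hg, h₂ _ hg (k.dom.mul_mem_left d hk), sub_self] }

/-- Multiplication by `a`, defined on all of `A`. -/
def ofElem (a : A) : DenseFraction A where
  dom := ⊤
  dense r hr := by simpa using hr 1 trivial
  map := a • (⊤ : Ideal A).subtype

/-- The sum, defined on the intersection of the domains. -/
def add (f g : DenseFraction A) : DenseFraction A where
  dom := f.dom ⊓ g.dom
  dense := dense_inf f.dense g.dense
  map := f.map ∘ₗ Submodule.inclusion inf_le_left + g.map ∘ₗ Submodule.inclusion inf_le_right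

/-- The negative. -/
def neg (f : DenseFraction A) : DenseFraction A where
  dom := f.dom
  dense := f.dense
  map := -f.map

/-- The composite `x ↦ f (g x)`, defined where `g x` is defined and in the domain of `f`. -/
def mul (f g : DenseFraction A) : DenseFraction A where
  dom :=
    { carrier := {x | ∃ h : x ∈ g.dom, g.map ⟨x, h⟩ ∈ f.dom}
      zero_mem' := ⟨g.dom.zero_mem, by
        have : g.map ⟨0, g.dom.zero_mem⟩ = 0 := g.map.map_zero
        rw [this]; exact f.dom.zero_mem⟩
      add_mem' := by
        rintro x y ⟨hx, hx'⟩ ⟨hy, hy'⟩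
        refine ⟨g.dom.add_mem hx hy, ?_⟩
        have : g.map ⟨x + y, g.dom.add_mem hx hy⟩ = g.map ⟨x, hx⟩ + g.map ⟨y, hy⟩ :=
          g.map.map_add ⟨x, hx⟩ ⟨y, hy⟩
        rw [this]; exact f.dom.add_mem hx' hy'
      smul_mem' := by
        rintro c x ⟨hx, hx'⟩
        refine ⟨g.dom.mul_mem_left c hx, ?_⟩
        have := g.map_mul_mem c x hx (g.dom.mul_mem_left c hx)
        simp only [smul_eq_mul]
        rw [this]; exact f.dom.mul_mem_left c hx' }
  dense := by
    intro r hr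
    refine f.dense r fun d hd => g.dense _ fun e he => ?_
    rw [mul_assoc]
    refine hr _ ⟨g.dom.mul_mem_left d he, ?_⟩
    rw [g.map_mul_mem d e he]
    exact f.dom.mul_mem_right _ hd
  map :=
    { toFun := fun x => f.map ⟨g.map ⟨x.1, x.2.1⟩, x.2.2⟩
      map_add' := by
        rintro ⟨x, hx, hx'⟩ ⟨y, hy, hy'⟩
        rw [← f.map.map_add]
        congr 1
        exact Subtype.ext (g.map.map_add ⟨x, hx⟩ ⟨y, hy⟩)
      map_smul' := by
        rintro c ⟨x, hx, hx'⟩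
        rw [RingHom.id_apply, ← f.map.map_smul]
        congr 1
        exact Subtype.ext (g.map.map_smul c ⟨x, hx⟩) }

theorem map_congr (f : DenseFraction A) {x y : A} (h : x = y) (hx : x ∈ f.dom) (hy : y ∈ f.dom) :
    f.map ⟨x, hx⟩ = f.map ⟨y, hy⟩ := by
  subst h; rfl

theorem mul_comm_equiv (f g : DenseFraction A) : mul f g ≈ mul g f := by
  rintro x ⟨hg, hfg⟩ ⟨hf, hgf⟩
  change f.map ⟨g.map ⟨x, hg⟩, hfg⟩ = g.map ⟨f.map ⟨x, hf⟩, hgf⟩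
  rw [← sub_eq_zero]
  refine f.dense _ fun d hd => g.dense _ fun e he => ?_
  have h1 : d * f.map ⟨g.map ⟨x, hg⟩, hfg⟩ = g.map ⟨x, hg⟩ * f.map ⟨d, hd⟩ := by
    rw [← f.map_mul_mem d _ hfg (f.dom.mul_mem_left d hfg),
      ← f.map_mul_mem _ d hd (f.dom.mul_mem_left _ hd)]
    exact f.map_congr (mul_comm _ _) _ _
  have h2 : e * g.map ⟨f.map ⟨x, hf⟩, hgf⟩ = f.map ⟨x, hf⟩ * g.map ⟨e, he⟩ := by
    rw [← g.map_mul_mem e _ hgf (g.dom.mul_mem_left e hgf),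
      ← g.map_mul_mem _ e he (g.dom.mul_mem_left _ he)]
    exact g.map_congr (mul_comm _ _) _ _
  have h3 : d * f.map ⟨x, hf⟩ = x * f.map ⟨d, hd⟩ := by
    rw [← f.map_mul_mem d _ hf (f.dom.mul_mem_left d hf),
      ← f.map_mul_mem _ d hd (f.dom.mul_mem_left _ hd)]
    exact f.map_congr (mul_comm _ _) _ _
  have h4 : e * g.map ⟨x, hg⟩ = x * g.map ⟨e, he⟩ := by
    rw [← g.map_mul_mem e _ hg (g.dom.mul_mem_left e hg),
      ← g.map_mul_mem _ e he (g.dom.mul_mem_left _ he)]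
    exact g.map_congr (mul_comm _ _) _ _
  linear_combination e * h1 - d * h2 + f.map ⟨d, hd⟩ * h4 - g.map ⟨e, he⟩ * h3

end DenseFraction

/-- The complete ring of quotients `Q(A)`: classes of `A`-linear maps `D → A` on dense ideals. -/
def CompleteQuotientRing (A : Type*) [CommRing A] : Type _ :=
  Quotient (DenseFraction.setoid A)

namespace CompleteQuotientRing

variable {A : Type*} [CommRing A]

instance : Zero (CompleteQuotientRing A) := ⟨Quotient.mk _ (DenseFraction.ofElem 0)⟩

instance : One (CompleteQuotientRing A) := ⟨Quotient.mk _ (DenseFraction.ofElem 1)⟩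

instance : Add (CompleteQuotientRing A) :=
  ⟨Quotient.map₂ DenseFraction.add (by
    intro f f' hf g g' hg x hx hx'
    exact congrArg₂ (· + ·) (hf x hx.1 hx'.1) (hg x hx.2 hx'.2))⟩

instance : Neg (CompleteQuotientRing A) :=
  ⟨Quotient.map DenseFraction.neg (by
    intro f f' hf x hx hx'
    exact congrArg Neg.neg (hf x hx hx'))⟩

instance : Mul (CompleteQuotientRing A) :=
  ⟨Quotient.map₂ DenseFraction.mul (by
    rintro f f' hf g g' hg x ⟨hx, hgx⟩ ⟨hx', hgx'⟩
    have e := hg x hx hx'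
    have hm : g.map ⟨x, hx⟩ ∈ f'.dom := e ▸ hgx'
    exact (hf _ hgx hm).trans (f'.map_congr e hm hgx'))⟩

theorem mul_comm' (x y : CompleteQuotientRing A) : x * y = y * x :=
  Quotient.inductionOn₂ x y fun f g => Quotient.sound (DenseFraction.mul_comm_equiv f g)

theorem add_comm' (x y : CompleteQuotientRing A) : x + y = y + x :=
  Quotient.inductionOn₂ x y fun _ _ => Quotient.sound fun _ _ _ => add_comm _ _

theorem zero_add' (x : CompleteQuotientRing A) : 0 + x = x :=
  Quotient.inductionOn x fun f => Quotient.sound fun x _ hx => by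
    change 0 * x + f.map ⟨x, hx⟩ = _
    rw [zero_mul, zero_add]

theorem one_mul' (x : CompleteQuotientRing A) : 1 * x = x :=
  Quotient.inductionOn x fun f => Quotient.sound fun x _ hx => by
    change 1 * f.map ⟨x, hx⟩ = _
    rw [one_mul]

theorem left_distrib' (x y z : CompleteQuotientRing A) : x * (y + z) = x * y + x * z := by
  refine Quotient.inductionOn₃ x y z fun f g k => Quotient.sound ?_
  rintro x ⟨hx, hx'⟩ ⟨⟨hg, hg'⟩, ⟨hk, hk'⟩⟩
  exact f.map.map_add ⟨g.map ⟨x, hg⟩, hg'⟩ ⟨k.map ⟨x, hk⟩, hk'⟩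

theorem zero_mul' (x : CompleteQuotientRing A) : 0 * x = 0 :=
  Quotient.inductionOn x fun f => Quotient.sound fun x hx _ => by
    change 0 * f.map ⟨x, hx.1⟩ = 0 * x
    rw [zero_mul, zero_mul]

instance : CommRing (CompleteQuotientRing A) where
  add_assoc x y z := Quotient.inductionOn₃ x y z fun _ _ _ =>
    Quotient.sound fun _ _ _ => add_assoc _ _ _
  zero_add := zero_add'
  add_zero x := by rw [add_comm', zero_add']
  add_comm := add_comm'
  nsmul := nsmulRec
  zsmul := zsmulRec
  neg_add_cancel x := Quotient.inductionOn x fun f => Quotient.sound fun x hx _ => by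
    change -f.map ⟨x, hx.1⟩ + f.map ⟨x, hx.2⟩ = 0 * x
    rw [zero_mul, neg_add_cancel]
  mul_assoc x y z := Quotient.inductionOn₃ x y z fun _ _ _ =>
    Quotient.sound fun _ _ _ => rfl
  one_mul := one_mul'
  mul_one x := by rw [mul_comm', one_mul']
  mul_comm := mul_comm'
  left_distrib := left_distrib'
  right_distrib x y z := by
    rw [mul_comm', left_distrib', mul_comm' z x, mul_comm' z y]
  zero_mul := zero_mul'
  mul_zero x := by rw [mul_comm', zero_mul']

/-- The canonical map `A → Q(A)`, sending `a` to multiplication by `a`. -/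
def ofRing (A : Type*) [CommRing A] : A →+* CompleteQuotientRing A where
  toFun a := Quotient.mk _ (DenseFraction.ofElem a)
  map_zero' := rfl
  map_one' := rfl
  map_add' a b := Quotient.sound fun x _ _ => add_mul a b x
  map_mul' a b := Quotient.sound fun x _ _ => mul_assoc a b x

instance : Algebra A (CompleteQuotientRing A) := (ofRing A).toAlgebra

end CompleteQuotientRing

/-- The Baer hull `B(A)`: the intersection of all Baer rings between `A` and `Q(A)`. -/
def baerHull (A : Type*) [CommRing A] : Subalgebra A (CompleteQuotientRing A) :=
  sInf {S | IsBaerRing S}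

/-! ### The Iliadis absolute -/

/-- The Gleason space `θX`: open ultrafilters on `X`, i.e. maximal proper filters of open sets. -/
def GleasonSpace (X : Type*) [TopologicalSpace X] : Type _ :=
  {F : Order.PFilter (Opens X) // Maximal (fun G : Order.PFilter (Opens X) => ⊥ ∉ G) F}

namespace GleasonSpace

variable {X : Type*} [TopologicalSpace X]

instance : TopologicalSpace (GleasonSpace X) :=
  generateFrom {s | ∃ U : Opens X, s = {F | U ∈ F.1}}

/-- The set of adherent points of an open ultrafilter. -/
def adherence (F : GleasonSpace X) : Set X :=
  ⋂ U ∈ F.1, closure (U : Set X)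

theorem mem_of_mem_adherence (F : GleasonSpace X) {x : X} (hx : x ∈ F.adherence)
    {U : Opens X} (hU : x ∈ U) : U ∈ F.1 := by
  let G : Order.PFilter (Opens X) := Order.IsPFilter.toPFilter (F := {W | ∃ V ∈ F.1, U ⊓ V ≤ W})
    (Order.IsPFilter.of_def ⟨⊤, ⊤, Order.PFilter.top_mem, le_top⟩
      (by
        rintro W ⟨V, hV, h⟩ W' ⟨V', hV', h'⟩
        exact ⟨W ⊓ W', ⟨V ⊓ V', Order.PFilter.inf_mem hV hV',
          le_inf ((inf_le_inf_left _ inf_le_left).trans h)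
            ((inf_le_inf_left _ inf_le_right).trans h')⟩, inf_le_left, inf_le_right⟩)
      (by
        rintro W W' hW ⟨V, hV, h⟩
        exact ⟨V, hV, h.trans hW⟩))
  have hG : ∀ W, W ∈ G ↔ ∃ V ∈ F.1, U ⊓ V ≤ W := fun _ => Iff.rfl
  have hbot : ⊥ ∉ G := by
    rw [hG]
    rintro ⟨V, hV, h⟩
    obtain ⟨y, hyU, hyV⟩ := mem_closure_iff.1 (Set.mem_iInter₂.1 hx V hV) U U.isOpen hU
    exact h (show y ∈ U ⊓ V from ⟨hyU, hyV⟩)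
  have hle : F.1 ≤ G := fun V hV => (hG V).2 ⟨V, hV, inf_le_right⟩
  exact F.2.2 hbot hle ((hG U).2 ⟨⊤, Order.PFilter.top_mem, inf_le_left⟩)

end GleasonSpace

/-- The Iliadis absolute `𝓔X` of a Hausdorff space `X`, as a subspace of `θX`: the open
ultrafilters that have an adherent point. -/
abbrev IliadisAbsolute (X : Type*) [TopologicalSpace X] : Type _ :=
  {F : GleasonSpace X // F.adherence.Nonempty}

/-- The projection of the absolute, sending an open ultrafilter to its adherent point, which is
unique when `X` is Hausdorff (see `IliadisAbsolute.adherence_eq`). -/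
noncomputable def IliadisAbsolute.proj {X : Type*} [TopologicalSpace X] (F : IliadisAbsolute X) :
    X :=
  F.2.some

theorem IliadisAbsolute.adherence_eq {X : Type*} [TopologicalSpace X] [T2Space X]
    (F : IliadisAbsolute X) : F.1.adherence = {F.proj} := by
  refine Set.eq_singleton_iff_unique_mem.2 ⟨F.2.some_mem, fun y hy => ?_⟩
  by_contra hne
  obtain ⟨U, V, hU, hV, hyU, hxV, hd⟩ := t2_separation hne
  have h1 : (⟨U, hU⟩ : Opens X) ∈ F.1.1 := F.1.mem_of_mem_adherence hy hyU
  have h2 : (⟨V, hV⟩ : Opens X) ∈ F.1.1 := F.1.mem_of_mem_adherence F.2.some_mem hxV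
  refine F.1.2.1 ?_
  have h3 := Order.PFilter.inf_mem h1 h2
  have : (⟨U, hU⟩ : Opens X) ⊓ ⟨V, hV⟩ = ⊥ := Opens.ext (Set.disjoint_iff_inter_eq_empty.1 hd)
  rwa [this] at h3

/-- The spectrum of a von Neumann regular ring is Hausdorff, so its absolute is defined. -/
theorem IsVonNeumannRegular.t2Space {A : Type*} [CommRing A] (hA : IsVonNeumannRegular A) :
    T2Space (PrimeSpectrum A) := by
  have key : ∀ (p q : PrimeSpectrum A) (a : A), a ∈ p.asIdeal → a ∉ q.asIdeal →
      ∃ U V : Set (PrimeSpectrum A), IsOpen U ∧ IsOpen V ∧ p ∈ U ∧ q ∈ V ∧ Disjoint U V := by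
    intro p q a hp hq
    obtain ⟨b, hb⟩ := hA a
    refine ⟨PrimeSpectrum.basicOpen (1 - a * b), PrimeSpectrum.basicOpen a,
      (PrimeSpectrum.basicOpen _).isOpen, (PrimeSpectrum.basicOpen _).isOpen, ?_, hq, ?_⟩
    · intro h
      refine p.isPrime.ne_top ((Ideal.eq_top_iff_one _).2 ?_)
      have := p.asIdeal.add_mem h (p.asIdeal.mul_mem_right b hp)
      rwa [sub_add_cancel] at this
    · rw [Set.disjoint_left]
      intro r h1 h2
      have h0 : (1 - a * b) * a ∈ r.asIdeal := by
        rw [sub_mul, one_mul, hb, sub_self]; exact r.asIdeal.zero_mem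
      exact (r.isPrime.mem_or_mem h0).elim h1 h2
  refine ⟨fun p q hpq => ?_⟩
  by_cases h : p.asIdeal ≤ q.asIdeal
  · have h' : ¬ q.asIdeal ≤ p.asIdeal := fun h' => hpq (PrimeSpectrum.ext (le_antisymm h h'))
    obtain ⟨a, hq, hp⟩ := Set.not_subset.1 h'
    obtain ⟨U, V, hU, hV, h1, h2, hd⟩ := key q p a hq hp
    exact ⟨V, U, hV, hU, h2, h1, hd.symm⟩
  · obtain ⟨a, hp, hq⟩ := Set.not_subset.1 h
    exact key p q a hp hq

/-! `A` is reduced, so for every ideal `I` the ideal `I + Ann I` is dense, and "identity on `I`,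
zero on `Ann I`" defines an idempotent of `Q(A)`. Applied to the ideal of elements supported in an
open `U ⊆ Spec A`, this gives an idempotent `e_U`, with `e_(U ∩ V) = e_U e_V` and `e_U = 0` only for
empty `U`. A ring between `A` and `Q(A)` is Baer iff it contains all idempotents of `Q(A)`; hence
`B(A)` is generated over `A` by idempotents (`baerHull_eq_adjoin`), and by regularity each of them
is some `e_U` (`exists_openIdempotent_eq`).

A prime `p` of `B(A)` yields the open ultrafilter `{U | e_U ∉ p}`, which adheres to `p ∩ A`. It
determines `p`, and every open ultrafilter arises in this way, so here the absolute is the whole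
Gleason space. The resulting continuous bijection from a compact to a Hausdorff space is a
homeomorphism, and `ψ` is its inverse. -/

namespace CompleteQuotientRing

variable {A : Type*} [CommRing A]

/-! ### Calculus in `Q(A)` -/

/-- The class of a fraction in `Q(A)`. -/
def mk (f : DenseFraction A) : CompleteQuotientRing A :=
  Quotient.mk _ f

theorem mk_surjective : Function.Surjective (mk : DenseFraction A → CompleteQuotientRing A) :=
  Quotient.mk_surjective

theorem mk_mul_algebraMap (f : DenseFraction A) (d : A) (hd : d ∈ f.dom) :
    mk f * algebraMap A _ d = algebraMap A _ (f.map ⟨d, hd⟩) := by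
  refine Quotient.sound ?_
  rintro x ⟨hx, hdx⟩ -
  change f.map ⟨d * x, hdx⟩ = f.map ⟨d, hd⟩ * x
  exact (f.map_congr (mul_comm d x) hdx (f.dom.mul_mem_left x hd)).trans
    ((f.map_mul_mem x d hd _).trans (mul_comm _ _))

theorem algebraMap_injective : Function.Injective (algebraMap A (CompleteQuotientRing A)) := by
  intro a b h
  have h1 := Quotient.exact h 1 trivial trivial
  change a * 1 = b * 1 at h1
  simpa using h1

theorem exists_dense_mul_mem (x : CompleteQuotientRing A) :
    ∃ D : Ideal A, IsDenseIdeal D ∧ ∀ d ∈ D, ∃ a, x * algebraMap A _ d = algebraMap A _ a := by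
  obtain ⟨f, rfl⟩ := mk_surjective x
  exact ⟨f.dom, f.dense, fun d hd => ⟨f.map ⟨d, hd⟩, mk_mul_algebraMap f d hd⟩⟩

/-- `D` need not lie in the domain of the fraction `f` representing `x`: for `y` in that domain and
`d ∈ D`, `d * f y = f (d * y)` vanishes, and density of `D` gives `f y = 0`. -/
theorem eq_zero_of_dense {D : Ideal A} (hD : IsDenseIdeal D) (x : CompleteQuotientRing A) :
    (∀ d ∈ D, x * algebraMap A _ d = 0) → x = 0 := by
  obtain ⟨f, rfl⟩ := mk_surjective x
  refine fun h => Quotient.sound fun y hy _ => ?_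
  change f.map ⟨y, hy⟩ = 0 * y
  rw [zero_mul]
  refine hD _ fun d hd => ?_
  have h1 := h (d * y) (D.mul_mem_right y hd)
  rw [mk_mul_algebraMap f _ (f.dom.mul_mem_left d hy), f.map_mul_mem d y hy] at h1
  rw [mul_comm]
  exact algebraMap_injective (h1.trans (map_zero _).symm)

/-! ### Idempotents attached to ideals -/

/-- In a reduced ring, the sum of an ideal and its annihilator is dense. -/
theorem isDenseIdeal_sup_annihilator [IsReduced A] (I : Ideal A) :
    IsDenseIdeal (I ⊔ I.annihilator) := by
  intro r hr
  have h1 : r ∈ I.annihilator :=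
    Submodule.mem_annihilator.2 fun i hi => hr i (Ideal.mem_sup_left hi)
  exact IsReduced.eq_zero r ⟨2, (pow_two r).trans (hr r (Ideal.mem_sup_right h1))⟩

theorem eq_of_eqOn [IsReduced A] (I : Ideal A) {x y : CompleteQuotientRing A}
    (h₁ : ∀ i ∈ I, x * algebraMap A _ i = y * algebraMap A _ i)
    (h₂ : ∀ j ∈ I.annihilator, x * algebraMap A _ j = y * algebraMap A _ j) : x = y := by
  rw [← sub_eq_zero]
  refine eq_zero_of_dense (isDenseIdeal_sup_annihilator I) _ fun d hd => ?_
  obtain ⟨i, hi, j, hj, rfl⟩ := Submodule.mem_sup.1 hd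
  rw [map_add, mul_add, sub_mul, sub_mul, h₁ i hi, h₂ j hj, sub_self, sub_self, add_zero]

/-- Reducedness gives `I ∩ Ann I = 0`, so the inclusion of `I` and the zero map on `Ann I` glue to a
linear map on the dense ideal `I + Ann I`. -/
theorem exists_mul_eq [IsReduced A] (I : Ideal A) : ∃ e : CompleteQuotientRing A,
    (∀ i ∈ I, e * algebraMap A _ i = algebraMap A _ i) ∧
      ∀ j ∈ I.annihilator, e * algebraMap A _ j = 0 := by
  let f : A →ₗ.[A] A := ⟨I, I.subtype⟩
  let g : A →ₗ.[A] A := ⟨I.annihilator, 0⟩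
  have hfg : ∀ (x : f.domain) (y : g.domain), (x : A) = y → f x = g y := by
    rintro ⟨x, hx⟩ ⟨y, hy⟩ h
    change x = 0
    change x = y at h
    subst h
    exact IsReduced.eq_zero x ⟨2, (pow_two x).trans (Submodule.mem_annihilator.1 hy x hx)⟩
  let F : DenseFraction A := ⟨I ⊔ I.annihilator, isDenseIdeal_sup_annihilator I, (f.sup g hfg).toFun⟩
  refine ⟨mk F, fun i hi => ?_, fun j hj => ?_⟩
  · rw [mk_mul_algebraMap F i (Ideal.mem_sup_left hi)]
    congr 1
    have := LinearPMap.sup_apply hfg ⟨i, hi⟩ ⟨0, zero_mem _⟩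
      ⟨i, Ideal.mem_sup_left hi⟩ (add_zero i)
    exact this.trans (add_zero i)
  · rw [mk_mul_algebraMap F j (Ideal.mem_sup_right hj), ← map_zero (algebraMap A _)]
    congr 1
    have := LinearPMap.sup_apply hfg ⟨0, zero_mem _⟩ ⟨j, hj⟩
      ⟨j, Ideal.mem_sup_right hj⟩ (zero_add j)
    exact this.trans (add_zero 0)

/-- The idempotent of `Q(A)` that is the identity on `I` and zero on its annihilator. -/
noncomputable def idealIdempotent [IsReduced A] (I : Ideal A) : CompleteQuotientRing A :=
  (exists_mul_eq I).choose

theorem idealIdempotent_mul [IsReduced A] {I : Ideal A} {i : A} (hi : i ∈ I) :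
    idealIdempotent I * algebraMap A _ i = algebraMap A _ i :=
  (exists_mul_eq I).choose_spec.1 i hi

theorem idealIdempotent_mul_annihilator [IsReduced A] {I : Ideal A} {j : A}
    (hj : j ∈ I.annihilator) : idealIdempotent I * algebraMap A _ j = 0 :=
  (exists_mul_eq I).choose_spec.2 j hj

theorem isIdempotentElem_idealIdempotent [IsReduced A] (I : Ideal A) :
    IsIdempotentElem (idealIdempotent I) := by
  refine eq_of_eqOn I (fun i hi => ?_) fun j hj => ?_
  · rw [mul_assoc, idealIdempotent_mul hi, idealIdempotent_mul hi]
  · rw [mul_assoc, idealIdempotent_mul_annihilator hj, mul_zero]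

theorem idealIdempotent_mul_eq_zero [IsReduced A] {I : Ideal A} {x : CompleteQuotientRing A}
    (h : ∀ i ∈ I, x * algebraMap A _ i = 0) : idealIdempotent I * x = 0 := by
  refine eq_of_eqOn I (fun i hi => ?_) fun j hj => ?_
  · rw [mul_assoc, h i hi, mul_zero, zero_mul]
  · rw [mul_right_comm, idealIdempotent_mul_annihilator hj, zero_mul, zero_mul]

/-! ### The Baer hull is generated by idempotents -/

/-- A Baer ring between `A` and `Q(A)` contains all idempotents of `Q(A)`. -/
theorem mem_of_isIdempotentElem {S : Subalgebra A (CompleteQuotientRing A)} (hS : IsBaerRing S)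
    {e : CompleteQuotientRing A} (he : IsIdempotentElem e) : e ∈ S := by
  -- In `Q(A)` the annihilator of `{y | e * y = 0}` is generated by `e`, so `f` should equal `e`.
  -- Since `e` is not yet known to lie in `S`, the comparison uses `a = e * d` and `d - a = (1 - e)
  -- * d`, which lie in `A` for `d` in a dense ideal.
  obtain ⟨f, hf, h⟩ := hS {y | e * y = 0}
  obtain ⟨D, hD, hDe⟩ := exists_dense_mul_mem e
  have hfe : (f : CompleteQuotientRing A) * (1 - e) = 0 := by
    refine eq_zero_of_dense hD _ fun d hd => ?_
    obtain ⟨a, ha⟩ := hDe d hd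
    have h1 := (h f).1 (Ideal.mem_span_singleton_self f) (algebraMap A S (d - a)) (by
      change e * algebraMap A (CompleteQuotientRing A) (d - a) = 0
      rw [map_sub, ← ha, mul_sub, ← mul_assoc, he.eq, sub_self])
    have h2 : (f : CompleteQuotientRing A) * algebraMap A _ (d - a) = 0 := congrArg Subtype.val h1
    rw [map_sub, ← ha] at h2
    rw [← h2]; ring
  have hef : (1 - (f : CompleteQuotientRing A)) * e = 0 := by
    refine eq_zero_of_dense hD _ fun d hd => ?_
    obtain ⟨a, ha⟩ := hDe d hd
    have h1 : algebraMap A S a ∈ Ideal.span {f} := by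
      refine (h _).2 fun y hy => Subtype.ext ?_
      change algebraMap A (CompleteQuotientRing A) a * (y : CompleteQuotientRing A) = 0
      have hy' : e * (y : CompleteQuotientRing A) = 0 := hy
      rw [← ha, mul_right_comm, hy', zero_mul]
    obtain ⟨c, hc⟩ := Ideal.mem_span_singleton.1 h1
    have hc' : algebraMap A (CompleteQuotientRing A) a = f * c := congrArg Subtype.val hc
    have hf' : (f : CompleteQuotientRing A) * f = f := congrArg Subtype.val hf
    rw [mul_assoc, ha, hc', sub_mul, one_mul, ← mul_assoc, hf', sub_self]
  have : e = f := by linear_combination hef - hfe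
  rw [this]; exact f.2

/-- A ring between `A` and `Q(A)` that contains all idempotents of `Q(A)` is Baer. -/
theorem isBaerRing_of_idempotents_mem [IsReduced A] {S : Subalgebra A (CompleteQuotientRing A)}
    (hS : ∀ e : CompleteQuotientRing A, IsIdempotentElem e → e ∈ S) : IsBaerRing S := by
  intro s
  let I : Ideal A :=
    { carrier := {a | ∀ y ∈ s, (y : CompleteQuotientRing A) * algebraMap A _ a = 0}
      zero_mem' := fun y _ => by rw [map_zero, mul_zero]
      add_mem' := fun {a b} ha hb y hy => by rw [map_add, mul_add, ha y hy, hb y hy, add_zero]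
      smul_mem' := fun c a ha y hy => by
        rw [smul_eq_mul, map_mul, mul_left_comm, ha y hy, mul_zero] }
  have hI := isIdempotentElem_idealIdempotent I
  refine ⟨⟨idealIdempotent I, hS _ hI⟩, Subtype.ext hI, fun x => ?_⟩
  rw [Ideal.mem_span_singleton]
  constructor
  · rintro ⟨c, rfl⟩ y hy
    refine Subtype.ext ?_
    change idealIdempotent I * (c : CompleteQuotientRing A) * y = 0
    rw [mul_right_comm, idealIdempotent_mul_eq_zero fun i (hi : i ∈ I) => hi y hy, zero_mul]
  · intro hx
    refine ⟨x, Subtype.ext ?_⟩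
    change (x : CompleteQuotientRing A) = idealIdempotent I * x
    obtain ⟨D, hD, hDx⟩ := exists_dense_mul_mem (x : CompleteQuotientRing A)
    rw [← sub_eq_zero]
    refine eq_zero_of_dense hD _ fun d hd => ?_
    obtain ⟨a, ha⟩ := hDx d hd
    have haI : a ∈ I := fun y hy => by
      have h1 : (x : CompleteQuotientRing A) * y = 0 := congrArg Subtype.val (hx y hy)
      rw [← ha, ← mul_assoc, mul_comm (y : CompleteQuotientRing A), h1, zero_mul]
    rw [sub_mul, mul_assoc, ha, idealIdempotent_mul haI, sub_self]

theorem mem_baerHull_of_isIdempotentElem {e : CompleteQuotientRing A} (he : IsIdempotentElem e) :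
    e ∈ baerHull A :=
  Algebra.mem_sInf.2 fun _ hS => mem_of_isIdempotentElem hS he

theorem baerHull_eq_adjoin [IsReduced A] :
    baerHull A = Algebra.adjoin A {e : CompleteQuotientRing A | IsIdempotentElem e} :=
  le_antisymm (sInf_le (isBaerRing_of_idempotents_mem fun _ he => Algebra.subset_adjoin he))
    (Algebra.adjoin_le fun _ he => mem_baerHull_of_isIdempotentElem he)

/-- Primes of the Baer hull are determined by their idempotents and their trace on `A`. -/
theorem prime_le_of_idempotents [IsReduced A] {p q : PrimeSpectrum (baerHull A)}
    (h : ∀ e : baerHull A, IsIdempotentElem e → (e ∈ p.asIdeal ↔ e ∈ q.asIdeal))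
    (hA : ∀ a : A, algebraMap A (baerHull A) a ∈ p.asIdeal →
      algebraMap A (baerHull A) a ∈ q.asIdeal) :
    p.asIdeal ≤ q.asIdeal := by
  -- Modulo a prime each idempotent is `0` or `1`, so each `x` is congruent to some `a : A`; by `h`
  -- the same `a` serves `p` and `q`.
  have key : ∀ x ∈ Algebra.adjoin A {e : CompleteQuotientRing A | IsIdempotentElem e},
      ∀ hx : x ∈ baerHull A, ∃ a : A, (⟨x, hx⟩ : baerHull A) - algebraMap A _ a ∈ p.asIdeal ∧
        (⟨x, hx⟩ : baerHull A) - algebraMap A _ a ∈ q.asIdeal := by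
    intro x hx
    induction hx using Algebra.adjoin_induction with
    | mem e he =>
      intro hx
      have he' : IsIdempotentElem (⟨e, hx⟩ : baerHull A) := Subtype.ext he
      by_cases hp : (⟨e, hx⟩ : baerHull A) ∈ p.asIdeal
      · exact ⟨0, by simpa using hp, by simpa using (h _ he').1 hp⟩
      · have h1 : (⟨e, hx⟩ : baerHull A) - 1 ∈ p.asIdeal :=
          (p.isPrime.mem_or_mem (x := ⟨e, hx⟩) (y := ⟨e, hx⟩ - 1) (by
            rw [mul_sub, he'.eq, mul_one, sub_self]; exact zero_mem _)).resolve_left hp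
        have h2 : (⟨e, hx⟩ : baerHull A) - 1 ∈ q.asIdeal := by
          rw [← neg_mem_iff, neg_sub] at h1 ⊢
          exact (h _ he'.one_sub).1 h1
        exact ⟨1, by simpa using h1, by simpa using h2⟩
    | algebraMap r =>
      intro hx
      have : (⟨_, hx⟩ : baerHull A) = algebraMap A _ r := rfl
      exact ⟨r, by rw [this, sub_self]; exact zero_mem _, by rw [this, sub_self]; exact zero_mem _⟩
    | add x y hx hy ihx ihy =>
      intro _
      rw [← baerHull_eq_adjoin] at hx hy
      obtain ⟨a, ha, ha'⟩ := ihx hx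
      obtain ⟨b, hb, hb'⟩ := ihy hy
      have : (⟨x + y, add_mem hx hy⟩ : baerHull A) - algebraMap A _ (a + b) =
          (⟨x, hx⟩ - algebraMap A _ a) + (⟨y, hy⟩ - algebraMap A _ b) := by
        have h1 : (⟨x + y, add_mem hx hy⟩ : baerHull A) = ⟨x, hx⟩ + ⟨y, hy⟩ := rfl
        rw [h1, map_add, add_sub_add_comm]
      exact ⟨a + b, by rw [this]; exact add_mem ha hb, by rw [this]; exact add_mem ha' hb'⟩
    | mul x y hx hy ihx ihy =>
      intro _
      rw [← baerHull_eq_adjoin] at hx hy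
      obtain ⟨a, ha, ha'⟩ := ihx hx
      obtain ⟨b, hb, hb'⟩ := ihy hy
      have : (⟨x * y, mul_mem hx hy⟩ : baerHull A) - algebraMap A _ (a * b) =
          ⟨y, hy⟩ * (⟨x, hx⟩ - algebraMap A _ a) +
            algebraMap A _ a * (⟨y, hy⟩ - algebraMap A _ b) := by
        have h1 : (⟨x * y, mul_mem hx hy⟩ : baerHull A) = ⟨x, hx⟩ * ⟨y, hy⟩ := rfl
        rw [h1, map_mul]; ring
      exact ⟨a * b,
        by rw [this]; exact add_mem (Ideal.mul_mem_left _ _ ha) (Ideal.mul_mem_left _ _ hb),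
        by rw [this]; exact add_mem (Ideal.mul_mem_left _ _ ha') (Ideal.mul_mem_left _ _ hb')⟩
  rintro ⟨x, hx⟩ hxp
  obtain ⟨a, ha, ha'⟩ := key x (baerHull_eq_adjoin (A := A) ▸ hx) hx
  exact (Submodule.sub_mem_iff_left _ (hA a ((Submodule.sub_mem_iff_right _ hxp).1 ha))).1 ha'

/-! ### Open subsets of the spectrum as idempotents -/

/-- The elements of `A` whose support lies in the open set `U`. -/
def supportIdeal (U : Opens (PrimeSpectrum A)) : Ideal A :=
  PrimeSpectrum.vanishingIdeal (U : Set (PrimeSpectrum A))ᶜ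

theorem mem_supportIdeal {U : Opens (PrimeSpectrum A)} {a : A} :
    a ∈ supportIdeal U ↔ ∀ x : PrimeSpectrum A, a ∉ x.asIdeal → x ∈ U := by
  rw [supportIdeal, PrimeSpectrum.mem_vanishingIdeal]
  exact forall_congr' fun x => not_imp_comm

theorem eq_zero_of_forall_mem [IsReduced A] {a : A} (h : ∀ x : PrimeSpectrum A, a ∈ x.asIdeal) :
    a = 0 := by
  refine IsNilpotent.eq_zero ?_
  rw [nilpotent_iff_mem_prime]
  exact fun J hJ => h ⟨J, hJ⟩

/-- The idempotent of the Baer hull attached to an open subset of the spectrum. -/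
noncomputable def openIdempotent [IsReduced A] (U : Opens (PrimeSpectrum A)) : baerHull A :=
  ⟨idealIdempotent (supportIdeal U),
    mem_baerHull_of_isIdempotentElem (isIdempotentElem_idealIdempotent _)⟩

theorem openIdempotent_mul_algebraMap [IsReduced A] {U : Opens (PrimeSpectrum A)} {a : A}
    (ha : a ∈ supportIdeal U) :
    openIdempotent U * algebraMap A (baerHull A) a = algebraMap A (baerHull A) a :=
  Subtype.ext (idealIdempotent_mul ha)

theorem openIdempotent_inf [IsReduced A] (U V : Opens (PrimeSpectrum A)) :
    openIdempotent (U ⊓ V) = openIdempotent U * openIdempotent V := by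
  refine Subtype.ext ?_
  change idealIdempotent _ = idealIdempotent _ * idealIdempotent _
  refine eq_of_eqOn (supportIdeal (U ⊓ V)) (fun i hi => ?_) fun j hj => ?_
  · rw [idealIdempotent_mul hi, mul_assoc, idealIdempotent_mul, idealIdempotent_mul]
    · exact mem_supportIdeal.2 fun x hx => (mem_supportIdeal.1 hi x hx).1
    · exact mem_supportIdeal.2 fun x hx => (mem_supportIdeal.1 hi x hx).2
  -- The product kills `j` because `j * i * k = 0` for `i` supported in `U` and `k` in `V`: then `i
  -- * k` is supported in `U ⊓ V`.
  · rw [idealIdempotent_mul_annihilator hj, mul_assoc]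
    refine (idealIdempotent_mul_eq_zero fun i hi => ?_).symm
    rw [mul_assoc]
    refine idealIdempotent_mul_eq_zero fun k hk => ?_
    rw [← map_mul, ← map_mul, mul_assoc]
    have hik : i * k ∈ supportIdeal (U ⊓ V) := by
      refine mem_supportIdeal.2 fun x hx => ⟨mem_supportIdeal.1 hi x fun h => hx ?_,
        mem_supportIdeal.1 hk x fun h => hx ?_⟩
      · exact Ideal.mul_mem_right _ _ h
      · exact Ideal.mul_mem_left _ _ h
    have := Submodule.mem_annihilator.1 hj _ hik
    rw [smul_eq_mul] at this
    rw [this, map_zero]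

theorem openIdempotent_top [IsReduced A] :
    openIdempotent (⊤ : Opens (PrimeSpectrum A)) = 1 := by
  have := openIdempotent_mul_algebraMap (A := A) (U := ⊤) (a := 1)
    (mem_supportIdeal.2 fun _ _ => trivial)
  simpa using this

theorem openIdempotent_eq_zero_iff [IsReduced A] {U : Opens (PrimeSpectrum A)} :
    openIdempotent U = 0 ↔ U = ⊥ := by
  constructor
  · intro h
    rw [eq_bot_iff]
    intro x hx
    obtain ⟨_, ⟨_, ⟨a, rfl⟩, rfl⟩, hxa, haU⟩ :=
      PrimeSpectrum.isBasis_basic_opens.exists_subset_of_mem_open hx U.isOpen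
    have h1 := openIdempotent_mul_algebraMap (U := U) (a := a)
      (mem_supportIdeal.2 fun y hy => haU hy)
    rw [h, zero_mul] at h1
    have h2 : a = 0 := algebraMap_injective
      ((congrArg Subtype.val h1).symm.trans (map_zero (algebraMap A _)).symm)
    exact absurd (h2 ▸ x.asIdeal.zero_mem) hxa
  · rintro rfl
    refine Subtype.ext ?_
    have h1 : (1 : A) ∈ (supportIdeal (⊥ : Opens (PrimeSpectrum A))).annihilator := by
      refine Submodule.mem_annihilator.2 fun a ha => ?_
      rw [one_smul]
      exact eq_zero_of_forall_mem fun x => by_contra fun hx => mem_supportIdeal.1 ha x hx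
    have := idealIdempotent_mul_annihilator h1
    rwa [map_one, mul_one] at this

end CompleteQuotientRing

namespace IsVonNeumannRegular

open CompleteQuotientRing

variable {A : Type*} [CommRing A]

theorem isReduced (hA : IsVonNeumannRegular A) : IsReduced A := by
  refine (isReduced_iff_pow_one_lt 2 one_lt_two).2 fun a ha => ?_
  obtain ⟨b, hb⟩ := hA a
  rw [← hb]
  linear_combination b * ha

theorem isRadical (hA : IsVonNeumannRegular A) (I : Ideal A) : I.IsRadical := by
  refine (Ideal.isRadical_iff_pow_one_lt 2 one_lt_two).2 fun a ha => ?_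
  obtain ⟨b, hb⟩ := hA a
  have : a = b * a ^ 2 := by linear_combination -hb
  rw [this]
  exact I.mul_mem_left _ ha

/-- Every idempotent of the Baer hull comes from an open subset of the spectrum. -/
theorem exists_openIdempotent_eq [IsReduced A] (hA : IsVonNeumannRegular A) {f : baerHull A}
    (hf : IsIdempotentElem f) : ∃ U, openIdempotent U = f := by
  have hf' : (f : CompleteQuotientRing A) * f = f := congrArg Subtype.val hf
  let J : Ideal A :=
    { carrier := {a | (f : CompleteQuotientRing A) * algebraMap A _ a = algebraMap A _ a}
      zero_mem' := by simp
      add_mem' := fun {a b} ha hb => by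
        rw [Set.mem_ofPred_eq] at ha hb ⊢
        rw [map_add, mul_add, ha, hb]
      smul_mem' := fun c a ha => by
        rw [Set.mem_ofPred_eq] at ha ⊢
        rw [smul_eq_mul, map_mul, mul_left_comm, ha] }
  let U : Opens (PrimeSpectrum A) :=
    ⟨(PrimeSpectrum.zeroLocus (J : Set A))ᶜ, (PrimeSpectrum.isClosed_zeroLocus _).isOpen_compl⟩
  -- Regularity enters here: `J`, the ideal of elements fixed by `f`, is radical and so is recovered
  -- from its zero locus.
  have hU : supportIdeal U = J := by
    change PrimeSpectrum.vanishingIdeal (PrimeSpectrum.zeroLocus (J : Set A))ᶜᶜ = J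
    rw [compl_compl, PrimeSpectrum.vanishingIdeal_zeroLocus_eq_radical, (hA.isRadical J).radical]
  refine ⟨U, Subtype.ext ?_⟩
  change idealIdempotent (supportIdeal U) = f
  rw [hU]
  refine eq_of_eqOn J (fun i hi => ?_) fun j hj => ?_
  · rw [idealIdempotent_mul hi]; exact hi.symm
  · rw [idealIdempotent_mul_annihilator hj]
    obtain ⟨D, hD, hDf⟩ := exists_dense_mul_mem (f : CompleteQuotientRing A)
    refine (eq_zero_of_dense hD _ fun d hd => ?_).symm
    obtain ⟨a, ha⟩ := hDf d hd
    have haJ : a ∈ J := by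
      change (f : CompleteQuotientRing A) * algebraMap A _ a = algebraMap A _ a
      rw [← ha, ← mul_assoc, hf']
    have := Submodule.mem_annihilator.1 hj a haJ
    rw [smul_eq_mul] at this
    rw [mul_right_comm, ha, ← map_mul, mul_comm, this, map_zero]

theorem exists_openIdempotent_compl [IsReduced A] (hA : IsVonNeumannRegular A)
    (U : Opens (PrimeSpectrum A)) :
    ∃ V, U ⊓ V = ⊥ ∧ openIdempotent V = 1 - openIdempotent U := by
  have hU : IsIdempotentElem (openIdempotent U) :=
    Subtype.ext (isIdempotentElem_idealIdempotent _)
  obtain ⟨V, hV⟩ := hA.exists_openIdempotent_eq hU.one_sub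
  refine ⟨V, openIdempotent_eq_zero_iff.1 ?_, hV⟩
  rw [openIdempotent_inf, hV, mul_sub, mul_one, hU.eq, sub_self]

/-- If `a * b * a = a`, the idempotent of `basicOpen a` is `a * b`, which generates the same ideal
as `a`. Thus the trace of a prime on `A` is visible from idempotents. -/
theorem openIdempotent_basicOpen_mem_iff [IsReduced A] (hA : IsVonNeumannRegular A)
    {p : PrimeSpectrum (baerHull A)} {a : A} :
    openIdempotent (PrimeSpectrum.basicOpen a) ∈ p.asIdeal ↔
      algebraMap A (baerHull A) a ∈ p.asIdeal := by
  have haU : a ∈ supportIdeal (PrimeSpectrum.basicOpen a) := mem_supportIdeal.2 fun _ h => h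
  obtain ⟨b, hb⟩ := hA a
  constructor
  · intro h
    rw [← openIdempotent_mul_algebraMap haU]
    exact Ideal.mul_mem_right _ _ h
  · intro h
    have : openIdempotent (PrimeSpectrum.basicOpen a) = algebraMap A (baerHull A) (a * b) := by
      refine Subtype.ext ?_
      change idealIdempotent _ = algebraMap A (CompleteQuotientRing A) (a * b)
      refine eq_of_eqOn (supportIdeal (PrimeSpectrum.basicOpen a)) (fun i hi => ?_) fun j hj => ?_
      · rw [idealIdempotent_mul hi, ← map_mul]
        congr 1
        rw [← sub_eq_zero]
        refine eq_zero_of_forall_mem fun x => ?_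
        by_cases hx : a ∈ x.asIdeal
        · have hix : i ∈ x.asIdeal := by_contra fun hix => mem_supportIdeal.1 hi x hix hx
          exact sub_mem hix (Ideal.mul_mem_left _ _ hix)
        · refine (x.isPrime.mem_or_mem (x := a) ?_).resolve_left hx
          have : a * (i - a * b * i) = 0 := by linear_combination -i * hb
          rw [this]; exact zero_mem _
      · have := Submodule.mem_annihilator.1 hj a haU
        rw [smul_eq_mul] at this
        rw [idealIdempotent_mul_annihilator hj, ← map_mul]
        have h0 : a * b * j = 0 := by linear_combination b * this
        rw [h0, map_zero]
    rw [this, map_mul]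
    exact Ideal.mul_mem_right _ _ h

/-! ### Primes of the Baer hull as open ultrafilters -/

/-- The open ultrafilter on `Spec A` attached to a prime of the Baer hull. -/
noncomputable def toGleason [IsReduced A] (hA : IsVonNeumannRegular A)
    (p : PrimeSpectrum (baerHull A)) : GleasonSpace (PrimeSpectrum A) :=
  ⟨Order.IsPFilter.toPFilter (F := {U | openIdempotent U ∉ p.asIdeal})
    (Order.IsPFilter.of_def
      ⟨⊤, by
        rw [Set.mem_ofPred_eq, openIdempotent_top]
        exact fun h => p.isPrime.ne_top ((Ideal.eq_top_iff_one _).2 h)⟩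
      (fun U hU V hV => ⟨U ⊓ V, by
        rw [Set.mem_ofPred_eq, openIdempotent_inf]
        exact fun h => (p.isPrime.mem_or_mem h).elim hU hV, inf_le_left, inf_le_right⟩)
      (by
        intro U V hUV hU hV
        refine hU ?_
        rw [← inf_eq_left.2 hUV, openIdempotent_inf]
        exact Ideal.mul_mem_left _ _ hV)),
    by
      refine ⟨fun h => h ?_, fun G hG hle U hU => ?_⟩
      · change openIdempotent ⊥ ∈ p.asIdeal
        rw [openIdempotent_eq_zero_iff.2 rfl]; exact zero_mem _
      · intro (hUp : openIdempotent U ∈ p.asIdeal)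
        -- Maximality: if `e_U ∈ p`, then `e_V = 1 - e_U ∉ p`, so a larger filter containing `U`
        -- also contains `U ⊓ V = ⊥`.
        obtain ⟨V, hUV, hV⟩ := hA.exists_openIdempotent_compl U
        have hVG : V ∈ G := hle (by
          change openIdempotent V ∉ p.asIdeal
          rw [hV]
          intro h
          refine p.isPrime.ne_top ((Ideal.eq_top_iff_one _).2 ?_)
          have := add_mem h hUp
          rwa [sub_add_cancel] at this)
        exact hG (hUV ▸ Order.PFilter.inf_mem hU hVG)⟩

theorem mem_toGleason [IsReduced A] (hA : IsVonNeumannRegular A) {p : PrimeSpectrum (baerHull A)}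
    {U : Opens (PrimeSpectrum A)} : U ∈ (hA.toGleason p).1 ↔ openIdempotent U ∉ p.asIdeal :=
  Iff.rfl

/-- A basic neighbourhood of `p ∩ A` is itself a member of the ultrafilter, hence meets every other
member. -/
theorem comap_mem_adherence_toGleason [IsReduced A] (hA : IsVonNeumannRegular A)
    (p : PrimeSpectrum (baerHull A)) :
    PrimeSpectrum.comap (algebraMap A (baerHull A)) p ∈ (hA.toGleason p).adherence := by
  refine Set.mem_iInter₂.2 fun U hU => ?_
  rw [PrimeSpectrum.isBasis_basic_opens.mem_closure_iff]
  rintro _ ⟨_, ⟨a, rfl⟩, rfl⟩ hpa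
  have ha : PrimeSpectrum.basicOpen a ∈ (hA.toGleason p).1 :=
    fun h => hpa (hA.openIdempotent_basicOpen_mem_iff.1 h)
  rw [Set.nonempty_iff_ne_empty]
  intro h
  refine (hA.toGleason p).2.1 ?_
  have h1 := Order.PFilter.inf_mem ha hU
  rwa [show PrimeSpectrum.basicOpen a ⊓ U = ⊥ from Opens.ext h] at h1

theorem toGleason_injective [IsReduced A] (hA : IsVonNeumannRegular A) :
    Function.Injective hA.toGleason := by
  intro p q hpq
  have h : ∀ U, openIdempotent U ∈ p.asIdeal ↔ openIdempotent U ∈ q.asIdeal := fun U => by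
    rw [← not_iff_not, ← hA.mem_toGleason, ← hA.mem_toGleason, hpq]
  have hid : ∀ e : baerHull A, IsIdempotentElem e → (e ∈ p.asIdeal ↔ e ∈ q.asIdeal) := by
    intro e he
    obtain ⟨U, rfl⟩ := hA.exists_openIdempotent_eq he
    exact h U
  have hmap : ∀ a : A, algebraMap A (baerHull A) a ∈ p.asIdeal ↔
      algebraMap A (baerHull A) a ∈ q.asIdeal := fun a => by
    rw [← hA.openIdempotent_basicOpen_mem_iff, h, hA.openIdempotent_basicOpen_mem_iff]
  exact PrimeSpectrum.ext (le_antisymm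
    (prime_le_of_idempotents hid fun a => (hmap a).1)
    (prime_le_of_idempotents (fun e he => (hid e he).symm) fun a => (hmap a).2))

/-- The `e_U` with `U ∈ F` form a multiplicative set without `0`. A prime avoiding it has an
ultrafilter containing `F`, hence equal to `F` by maximality. -/
theorem toGleason_surjective [IsReduced A] (hA : IsVonNeumannRegular A) :
    Function.Surjective hA.toGleason := by
  intro F
  let S : Submonoid (baerHull A) :=
    { carrier := {e | ∃ U ∈ F.1, openIdempotent U = e}
      one_mem' := ⟨⊤, Order.PFilter.top_mem, openIdempotent_top⟩
      mul_mem' := by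
        rintro _ _ ⟨U, hU, rfl⟩ ⟨V, hV, rfl⟩
        exact ⟨U ⊓ V, Order.PFilter.inf_mem hU hV, openIdempotent_inf U V⟩ }
  have hS : Disjoint ((⊥ : Ideal (baerHull A)) : Set (baerHull A)) S := by
    rw [Set.disjoint_left]
    rintro e he ⟨U, hU, rfl⟩
    exact F.2.1 (openIdempotent_eq_zero_iff.1 he ▸ hU)
  obtain ⟨p, hp, -, hpS⟩ := Ideal.exists_le_prime_disjoint ⊥ S hS
  have hle : F.1 ≤ (hA.toGleason ⟨p, hp⟩).1 := fun U hU hUp =>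
    Set.disjoint_left.1 hpS hUp ⟨U, hU, rfl⟩
  exact ⟨⟨p, hp⟩, Subtype.ext (le_antisymm (F.2.2 (hA.toGleason ⟨p, hp⟩).2.1 hle) hle)⟩

theorem continuous_toGleason [IsReduced A] (hA : IsVonNeumannRegular A) :
    Continuous hA.toGleason := by
  refine continuous_generateFrom_iff.2 ?_
  rintro _ ⟨U, rfl⟩
  exact (PrimeSpectrum.basicOpen (openIdempotent U)).isOpen

theorem t2Space_gleasonSpace [IsReduced A] (hA : IsVonNeumannRegular A) :
    T2Space (GleasonSpace (PrimeSpectrum A)) := by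
  refine ⟨fun F G hFG => ?_⟩
  obtain ⟨q, rfl⟩ := hA.toGleason_surjective G
  obtain ⟨U, hUF, hUq⟩ : ∃ U ∈ F.1, U ∉ (hA.toGleason q).1 := by
    by_contra! h
    exact hFG (Subtype.ext (le_antisymm h (F.2.2 (hA.toGleason q).2.1 h)))
  obtain ⟨V, hUV, hV⟩ := hA.exists_openIdempotent_compl U
  refine ⟨{H | U ∈ H.1}, {H | V ∈ H.1}, isOpen_generateFrom_of_mem ⟨U, rfl⟩,
    isOpen_generateFrom_of_mem ⟨V, rfl⟩, hUF,
    fun (h : openIdempotent V ∈ q.asIdeal) => ?_, ?_⟩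
  · refine q.isPrime.ne_top ((Ideal.eq_top_iff_one _).2 ?_)
    have h1 := add_mem h (not_not.1 (mt hA.mem_toGleason.2 hUq))
    rwa [hV, sub_add_cancel] at h1
  · rw [Set.disjoint_left]
    intro H (h1 : U ∈ H.1) (h2 : V ∈ H.1)
    have h3 := Order.PFilter.inf_mem h1 h2
    rw [hUV] at h3
    exact H.2.1 h3

end IsVonNeumannRegular

theorem mainTheorem6 {A : Type*} [CommRing A] (hA : IsVonNeumannRegular A) :
    ∃ ψ : IliadisAbsolute (PrimeSpectrum A) ≃ₜ PrimeSpectrum (baerHull A),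
      PrimeSpectrum.comap (algebraMap A (baerHull A)) ∘ ψ = IliadisAbsolute.proj := by
  have := hA.isReduced
  have := hA.t2Space
  have := hA.t2Space_gleasonSpace
  let f : PrimeSpectrum (baerHull A) → IliadisAbsolute (PrimeSpectrum A) :=
    fun p => ⟨hA.toGleason p, _, hA.comap_mem_adherence_toGleason p⟩
  have hf : Function.Bijective f :=
    ⟨fun p q h => hA.toGleason_injective (congrArg Subtype.val h), fun F => by
      obtain ⟨p, hp⟩ := hA.toGleason_surjective F.1
      exact ⟨p, Subtype.ext hp⟩⟩
  have hc : Continuous (Equiv.ofBijective f hf) :=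
    Continuous.subtype_mk hA.continuous_toGleason _
  -- A prime spectrum is compact, and the absolute is a subspace of the Hausdorff Gleason space.
  let φ := hc.homeoOfEquivCompactToT2
  refine ⟨φ.symm, funext fun F => ?_⟩
  obtain ⟨p, rfl⟩ := φ.surjective F
  rw [Function.comp_apply, φ.symm_apply_apply]
  have h := hA.comap_mem_adherence_toGleason p
  exact (IliadisAbsolute.adherence_eq (φ p)).subset h
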